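/- Let $\eta$ be the Dedekind eta function on the upper half-plane $\mathbb H$, $\zeta_{24}=e^{2\pi i/24}$, $S=\begin{pmatrix}0&-1\\1&0\end{pmatrix}$, and write $(f\circ S)(z)=f(Sz)=f(-1/z)$. Let $p$ be a prime. For $0\le\nu<p^2$ put $$A_\nu(z)=\frac{\eta\left(\frac{z+\nu}{p}\right)^2}{\eta(z+\nu)\,\eta\left(\frac{z+\nu}{p^2}\right)}.$$ For $1\le\nu<p$ put $$C_\nu(z)=\sqrt p\;\varepsilon(\nu)\,\zeta_{24}^{\theta(\nu)}\,\frac{\eta(pz)^2}{\eta(z)\,\eta\left(z+\frac{\nu}{p}\right)},$$ where, with $\mu\in\{1,\dots,p-1\}$ and $v\in\mathbb Z$ determined by $1=-\mu\nu+vp$: if $p$ is odd, $\varepsilon(\nu)=\left(\frac{-\nu}{p}\right)$ (Legendre symbol) and $\theta(\nu)=p\nu(1-\mu^2)+(-3p+2+v)\mu-3+3p$; if $p=2$, $\varepsilon(\nu)=1$ and $\theta(\nu)=0$. (i) If $\nu=\rho p$ with $1\le\rho<p$, and $\varpi\in\{1,\dots,p-1\}$, $w\in\mathbb Z$ satisfy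 $1=-\varpi\rho+wp$, then $A_\nu\circ S=C_\varpi$ on $\mathbb H$. (ii) If $1\le\nu<p$ and $\mu\in\{1,\dots,p-1\}$ satisfies $\mu\equiv-1/\nu \pmod p$, then $C_\nu\circ S=A_{\mu p}$ on $\mathbb H$. -/

import Mathlib

noncomputable section

namespace DoubleEta

open Complex

/-- The root of unity `ζ_n = exp (2 π i / n)`. -/
def zeta (n : ℕ) : ℂ := exp (2 * Real.pi * I / n)

/-- The double eta quotient
`𝔴_{p₁,p₂}(z) = η(z/p₁) η(z/p₂) / (η(z) η(z/(p₁p₂)))`, written at a point `z` of `ℂ`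
(it is only used at points with positive imaginary part). -/
def doubleEta (p₁ p₂ : ℕ) (z : ℂ) : ℂ :=
  ModularForm.eta (z / p₁) * ModularForm.eta (z / p₂) /
    (ModularForm.eta z * ModularForm.eta (z / (p₁ * p₂)))

/-- The conjugate `A_ν(z) = 𝔴_{p₁,p₂}(z + ν)` of `𝔴_{p₁,p₂}` (for `0 ≤ ν < p₁p₂`). -/
def conjA (p₁ p₂ ν : ℕ) (z : UpperHalfPlane) : ℂ :=
  doubleEta p₁ p₂ ((z : ℂ) + ν)

/-- The representative `μ ∈ {1, …, p-1}` of `-1/ν` modulo the prime `p`, for `1 ≤ ν < p`. -/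
def negInv (p ν : ℕ) : ℕ := (-(ν : ZMod p)⁻¹).val

/-- The integer `v` such that `1 = -μ ν + v p`, where `μ = negInv p ν`. -/
def cofactor (p ν : ℕ) : ℤ := (1 + (negInv p ν : ℤ) * ν) / p

/-- For `p` prime and `1 ≤ ν < p`, the numbers `μ = negInv p ν` and `v = cofactor p ν` satisfy
`1 ≤ μ < p` and `1 = -μ ν + v p`. -/
theorem negInv_spec (p ν : ℕ) [Fact p.Prime] (h1 : 1 ≤ ν) (h2 : ν < p) :
    1 ≤ negInv p ν ∧ negInv p ν < p ∧
      (1 : ℤ) = -(negInv p ν : ℤ) * ν + cofactor p ν * p := by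
  have hν : (ν : ZMod p) ≠ 0 := by
    rw [Ne, ZMod.natCast_eq_zero_iff]
    exact Nat.not_dvd_of_pos_of_lt h1 h2
  have hc : ((negInv p ν : ℕ) : ZMod p) = -(ν : ZMod p)⁻¹ := ZMod.natCast_zmod_val _
  refine ⟨?_, ZMod.val_lt _, ?_⟩
  · rw [Nat.one_le_iff_ne_zero]
    intro h
    rw [h] at hc
    simp at hc
    exact hν hc
  · have hd : (p : ℤ) ∣ 1 + (negInv p ν : ℤ) * ν := by
      rw [← ZMod.intCast_zmod_eq_zero_iff_dvd]
      push_cast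
      rw [hc]
      field_simp
      ring
    have := Int.ediv_mul_cancel hd
    unfold cofactor
    linarith

/-- The sign `ε(ν)`: the Legendre symbol `(-ν / p)` if `p` is odd, and `1` if `p = 2`. -/
def sign (p ν : ℕ) [Fact p.Prime] : ℤ :=
  if p = 2 then 1 else legendreSym p (-(ν : ℤ))

/-- The exponent `θ(ν)`: with `μ ∈ {1, …, p-1}` and `v` such that `1 = -μ ν + v p`, it is
`p ν (1 - μ²) + (-3p + 2 + v) μ - 3 + 3p` if `p` is odd, and `0` if `p = 2`. -/
def theta (p ν : ℕ) : ℤ :=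
  if p = 2 then 0
  else
    (p : ℤ) * ν * (1 - (negInv p ν : ℤ) ^ 2) +
      (-3 * (p : ℤ) + 2 + cofactor p ν) * (negInv p ν : ℤ) - 3 + 3 * (p : ℤ)

/-- The function
`C_ν(z) = √p ε(ν) ζ₂₄^{θ(ν)} η(pz)² / (η(z) η(z + ν/p))`, for `1 ≤ ν < p`. -/
def conjC (p ν : ℕ) [Fact p.Prime] (z : UpperHalfPlane) : ℂ :=
  (Real.sqrt p : ℂ) * (sign p ν : ℂ) * zeta 24 ^ theta p ν *
    (ModularForm.eta (p * (z : ℂ)) ^ 2 /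
      (ModularForm.eta (z : ℂ) * ModularForm.eta ((z : ℂ) + (ν : ℂ) / p)))

end DoubleEta

end

namespace DoubleEta

open Complex NumberTheorySymbols

/-! At `-1/z` the three distinct eta values in `A_{ρp}` are governed by integer matrices. Two need
only `T` and `S`; the third is `η` at `(ρz' - w)/(pz' - ϖ)` with `z' = z + ϖ/p`, where `pz' - ϖ =
pz`. The square roots combine to `√p`, and (i) becomes an identity between `ζ₂₄` powers and the
multiplier of `(ρ -w; p -ϖ)`. For odd `c > 0` this multiplier is a Jacobi symbol times a power of
`ζ₂₄` (`hasEtaMultiplier_of_odd`), proved by a Euclidean descent on `c` in which quadratic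
reciprocity matches the effect of `S`. The case `p = 2` is a single matrix. Part (ii) is (i)
composed with `S`, an involution on the half-plane. -/

theorem zeta_ne_zero (n : ℕ) : zeta n ≠ 0 := exp_ne_zero _

theorem zeta_zpow (n : ℕ) (m : ℤ) : zeta n ^ m = exp (2 * Real.pi * I * m / n) := by
  rw [zeta, ← exp_int_mul]
  ring_nf

theorem zeta_pow_self {n : ℕ} (hn : n ≠ 0) : zeta n ^ n = 1 := by
  have : (n : ℂ) ≠ 0 := Nat.cast_ne_zero.mpr hn
  rw [zeta, ← exp_nat_mul, mul_div_cancel₀ _ this, exp_two_pi_mul_I]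

theorem zeta_zpow_congr {n : ℕ} (hn : n ≠ 0) {k l : ℤ} (h : (n : ℤ) ∣ k - l) :
    zeta n ^ k = zeta n ^ l := by
  obtain ⟨t, ht⟩ := h
  rw [show k = l + n * t by linarith, zpow_add₀ (zeta_ne_zero n), zpow_mul, zpow_natCast,
    zeta_pow_self hn, one_zpow, mul_one]

theorem zeta_twentyFour_zpow_twelve : zeta 24 ^ (12 : ℤ) = -1 := by
  rw [zeta_zpow, ← exp_pi_mul_I]
  congr 1
  push_cast
  ring

theorem zeta_twentyFour_zpow_six : zeta 24 ^ (6 : ℤ) = I := by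
  rw [zeta_zpow]
  refine Eq.trans ?_ exp_pi_div_two_mul_I
  congr 1
  push_cast
  ring

theorem sqrt_I_eq_zeta : sqrt I = zeta 24 ^ (3 : ℤ) := by
  rw [sqrt_eq_exp I_ne_zero, log_I, zeta_zpow]
  congr 1
  push_cast
  ring

theorem eta_add_int (z : ℂ) (n : ℤ) :
    ModularForm.eta (z + n) = zeta 24 ^ n * ModularForm.eta z := by
  have h1 (k : ℕ) : ModularForm.eta_q k (z + n) = ModularForm.eta_q k z := by
    rw [ModularForm.eta_q_eq_pow, ModularForm.eta_q_eq_pow,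
      show 2 * Real.pi * I * (z + n) = 2 * Real.pi * I * z + n * (2 * Real.pi * I) by ring,
      exp_add, exp_int_mul_two_pi_mul_I, mul_one]
  have h2 : Function.Periodic.qParam 24 (z + n) =
      zeta 24 ^ n * Function.Periodic.qParam 24 z := by
    rw [zeta_zpow, Function.Periodic.qParam, Function.Periodic.qParam, ← exp_add]
    congr 1
    push_cast
    ring
  simp only [ModularForm.eta, h1, h2, mul_assoc]

theorem eta_neg_one_div {z : ℂ} (hz : 0 < z.im) :
    ModularForm.eta (-1 / z) = zeta 24 ^ (-3 : ℤ) * sqrt z * ModularForm.eta z := by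
  have := ModularForm.eta_comp_eq_csqrt_I_inv (x := z) hz
  simp only [Function.comp, Pi.smul_apply, Pi.mul_apply, smul_eq_mul] at this
  rw [this, sqrt_I_eq_zeta, zpow_neg, mul_assoc]

/-! ### Branches of the square root -/

theorem eq_of_exp_eq_of_abs_im_sub_lt {x y : ℂ} (h : exp x = exp y)
    (hxy : |x.im - y.im| < 2 * Real.pi) : x = y := by
  obtain ⟨n, hn⟩ := exp_eq_exp_iff_exists_int.mp h
  have him : x.im - y.im = n * (2 * Real.pi) := by simp [hn]
  rw [him, abs_mul, abs_of_pos Real.two_pi_pos] at hxy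
  have h1 : |(n : ℝ)| < 1 := by
    by_contra! h1
    nlinarith [Real.pi_pos]
  have h0 : n = 0 := by
    rw [← Int.abs_lt_one_iff]
    exact_mod_cast h1
  simpa [h0] using hn

theorem ne_zero_of_im_pos {z : ℂ} (hz : 0 < z.im) : z ≠ 0 := by
  rintro rfl
  simp at hz

theorem log_im_mem_Ioo_of_im_pos {z : ℂ} (hz : 0 < z.im) : (log z).im ∈ Set.Ioo 0 Real.pi := by
  rw [log_im]
  refine ⟨(arg_nonneg_iff.mpr hz.le).lt_of_ne fun h ↦ ?_, (arg_le_pi z).lt_of_ne fun h ↦ ?_⟩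
  · exact hz.ne' (arg_eq_zero_iff.mp h.symm).2
  · exact hz.ne' (arg_eq_pi_iff.mp h).2

/-- All three arguments lie in `(0, π)`, so the two sides of the logarithm identity differ by less
than `2π` in imaginary part: no branch jump. -/
theorem sqrt_mul_of_im_pos {w z : ℂ} (hw : 0 < w.im) (hz : 0 < z.im) (hwz : 0 < (w * z).im) :
    sqrt w * sqrt z = sqrt (w * z) := by
  have h : log w + log z = log (w * z) := by
    apply eq_of_exp_eq_of_abs_im_sub_lt
    · rw [exp_add, exp_log (ne_zero_of_im_pos hw), exp_log (ne_zero_of_im_pos hz),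
        exp_log (ne_zero_of_im_pos hwz)]
    · have h1 := log_im_mem_Ioo_of_im_pos hw
      have h2 := log_im_mem_Ioo_of_im_pos hz
      have h3 := log_im_mem_Ioo_of_im_pos hwz
      simp only [Set.mem_Ioo] at h1 h2 h3
      rw [add_im, abs_lt]
      constructor <;> linarith
  rw [sqrt_eq_exp (ne_zero_of_im_pos hw), sqrt_eq_exp (ne_zero_of_im_pos hz),
    sqrt_eq_exp (ne_zero_of_im_pos hwz), ← exp_add, ← h]
  ring_nf

/-- The logarithms now add up to `log (-(w * z)) + πi`; halving `πi` produces the factor `I`. -/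
theorem sqrt_mul_of_im_pos_of_neg {w z : ℂ} (hw : 0 < w.im) (hz : 0 < z.im)
    (hwz : 0 < (-(w * z)).im) : sqrt w * sqrt z = I * sqrt (-(w * z)) := by
  have h : log w + log z = log (-(w * z)) + Real.pi * I := by
    apply eq_of_exp_eq_of_abs_im_sub_lt
    · rw [exp_add, exp_add, exp_log (ne_zero_of_im_pos hw), exp_log (ne_zero_of_im_pos hz),
        exp_log (ne_zero_of_im_pos hwz), exp_pi_mul_I]
      ring
    · have h1 := log_im_mem_Ioo_of_im_pos hw
      have h2 := log_im_mem_Ioo_of_im_pos hz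
      have h3 := log_im_mem_Ioo_of_im_pos hwz
      simp only [Set.mem_Ioo] at h1 h2 h3
      rw [add_im, add_im, abs_lt]
      simp only [mul_im, ofReal_re, I_im, ofReal_im, I_re]
      constructor <;> linarith
  rw [sqrt_eq_exp (ne_zero_of_im_pos hw), sqrt_eq_exp (ne_zero_of_im_pos hz),
    sqrt_eq_exp (ne_zero_of_im_pos hwz), ← exp_pi_div_two_mul_I, ← exp_add, ← exp_add,
    ← add_div, h]
  ring_nf

theorem sqrt_sq (z : ℂ) : sqrt z ^ 2 = z := by
  simp [sqrt]

theorem sqrt_natCast_mul {z : ℂ} (hz : z ≠ 0) {p : ℕ} (hp : 0 < p) :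
    sqrt (p * z) = (Real.sqrt p : ℂ) * sqrt z := by
  have hp' : (0 : ℝ) < p := by exact_mod_cast hp
  rw [← ofReal_natCast, sqrt_eq_exp (mul_ne_zero (by exact_mod_cast hp'.ne') hz),
    log_ofReal_mul hp' hz, add_div, exp_add, ← sqrt_eq_exp hz, Real.sqrt_eq_rpow,
    Real.rpow_def_of_pos hp']
  push_cast
  ring_nf

/-! ### Multipliers under `T` and `S` -/

theorem im_neg_one_div_pos {z : ℂ} (hz : 0 < z.im) : 0 < (-1 / z).im := by
  rw [neg_div, one_div, neg_im, inv_im, neg_div, neg_neg]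
  exact div_pos hz (normSq_pos.mpr (ne_zero_of_im_pos hz))

/-- `u` is the multiplier of `η` for the matrix `(a b; c d)`:
`η((az + b)/(cz + d)) = u √(cz + d) η(z)` on the upper half-plane. -/
def HasEtaMultiplier (a b c d : ℤ) (u : ℂ) : Prop :=
  ∀ z : ℂ, 0 < z.im → ModularForm.eta ((a * z + b) / (c * z + d)) =
    u * sqrt (c * z + d) * ModularForm.eta z

theorem im_intCast_mul_add_intCast (c d : ℤ) (z : ℂ) : ((c : ℂ) * z + d).im = c * z.im := by
  simp

theorem hasEtaMultiplier_S : HasEtaMultiplier 0 (-1) 1 0 (zeta 24 ^ (-3 : ℤ)) := by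
  intro z hz
  simpa using eta_neg_one_div hz

namespace HasEtaMultiplier

variable {a b c d : ℤ} {u : ℂ}

theorem T_zpow_mul (h : HasEtaMultiplier a b c d u) (hc : 0 < c) (n : ℤ) :
    HasEtaMultiplier (a + n * c) (b + n * d) c d (zeta 24 ^ n * u) := by
  intro z hz
  have hj : (c : ℂ) * z + d ≠ 0 := by
    apply ne_zero_of_im_pos
    rw [im_intCast_mul_add_intCast]
    positivity
  have : (((a + n * c : ℤ) : ℂ) * z + (b + n * d : ℤ)) / (c * z + d) =
      (a * z + b) / (c * z + d) + n := by
    push_cast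
    field_simp
    ring
  rw [this, eta_add_int, h z hz]
  ring

theorem mul_T_zpow (h : HasEtaMultiplier a b c d u) (n : ℤ) :
    HasEtaMultiplier a (b + n * a) c (d + n * c) (u * zeta 24 ^ n) := by
  intro z hz
  have := h (z + n) (by simpa using hz)
  rw [eta_add_int] at this
  rw [show (a : ℂ) * z + (b + n * a : ℤ) = a * (z + n) + b by push_cast; ring,
    show (c : ℂ) * z + (d + n * c : ℤ) = c * (z + n) + d by push_cast; ring, this]
  ring

theorem mul_S (h : HasEtaMultiplier a b c d u) (hc : 0 < c) (hd : 0 < d) :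
    HasEtaMultiplier b (-a) d (-c) (zeta 24 ^ (-3 : ℤ) * u) := by
  intro z hz
  have hz0 := ne_zero_of_im_pos hz
  have hS := im_neg_one_div_pos hz
  have hj : 0 < ((d : ℂ) * z + (-c : ℤ)).im := by
    rw [im_intCast_mul_add_intCast]
    positivity
  have hw : 0 < ((c : ℂ) * (-1 / z) + d).im := by
    rw [im_intCast_mul_add_intCast]
    positivity
  have hwz : ((c : ℂ) * (-1 / z) + d) * z = d * z + (-c : ℤ) := by
    push_cast
    field_simp
    ring
  have hfrac : ((b : ℂ) * z + (-a : ℤ)) / (d * z + (-c : ℤ)) =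
      (a * (-1 / z) + b) / (c * (-1 / z) + d) := by
    rw [← hwz, div_eq_div_iff (mul_ne_zero (ne_zero_of_im_pos hw) hz0) (ne_zero_of_im_pos hw)]
    push_cast
    field_simp
    ring
  have hs := sqrt_mul_of_im_pos hw hz (by rwa [hwz])
  rw [hwz] at hs
  rw [hfrac, h _ hS, eta_neg_one_div hz, ← hs]
  ring

/-- Negating the matrix keeps the lower-left entry positive; the resulting factor `I = ζ₂₄⁶` turns
`ζ₂₄⁻³` into `ζ₂₄³`. -/
theorem mul_S_inv (h : HasEtaMultiplier a b c d u) (hc : 0 < c) (hd : d < 0) :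
    HasEtaMultiplier (-b) a (-d) c (zeta 24 ^ (3 : ℤ) * u) := by
  intro z hz
  have hz0 := ne_zero_of_im_pos hz
  have hS := im_neg_one_div_pos hz
  have hj : 0 < (((-d : ℤ) : ℂ) * z + c).im := by
    rw [im_intCast_mul_add_intCast]
    exact mul_pos (by exact_mod_cast neg_pos.mpr hd) hz
  have hw : 0 < ((c : ℂ) * (-1 / z) + d).im := by
    rw [im_intCast_mul_add_intCast]
    positivity
  have hwz : -(((c : ℂ) * (-1 / z) + d) * z) = (-d : ℤ) * z + c := by
    push_cast
    field_simp
    ring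
  have hfrac : (((-b : ℤ) : ℂ) * z + a) / ((-d : ℤ) * z + c) =
      (a * (-1 / z) + b) / (c * (-1 / z) + d) := by
    rw [← hwz, div_eq_div_iff (neg_ne_zero.mpr (mul_ne_zero (ne_zero_of_im_pos hw) hz0))
      (ne_zero_of_im_pos hw)]
    push_cast
    field_simp
    ring
  have hs := sqrt_mul_of_im_pos_of_neg hw hz (by rwa [hwz])
  rw [hwz] at hs
  have hI : zeta 24 ^ (-3 : ℤ) * I = zeta 24 ^ (3 : ℤ) := by
    rw [← zeta_twentyFour_zpow_six, ← zpow_add₀ (zeta_ne_zero 24)]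
    norm_num
  rw [hfrac, h _ hS, eta_neg_one_div hz, ← hI]
  linear_combination (zeta 24 ^ (-3 : ℤ) * u * ModularForm.eta z) * hs

end HasEtaMultiplier

/-- The exponent of `ζ₂₄` in the multiplier of `η` for the matrix `(a b; c d)` with odd `c > 0`. -/
def etaExponent (a b c d : ℤ) : ℤ := (a + d) * c - b * d * (c ^ 2 - 1) - 3 * c

/-- The multiplier of `η` for the matrix `(a b; c d)` with odd `c > 0`. -/
noncomputable def etaMultiplier (a b : ℤ) (c : ℕ) (d : ℤ) : ℂ :=
  (J(d | c) : ℂ) * zeta 24 ^ etaExponent a b c d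

/-! ### Congruences modulo 24 and reciprocity -/

theorem dvd_twentyFour_of_eq_zero {x : ℤ} (h3 : (x : ZMod 3) = 0) (h8 : (x : ZMod 8) = 0) :
    (24 : ℤ) ∣ x := by
  have h3' := (ZMod.intCast_zmod_eq_zero_iff_dvd x 3).mp h3
  have h8' := (ZMod.intCast_zmod_eq_zero_iff_dvd x 8).mp h8
  omega

theorem sq_eq_one_of_eq_two_mul_add_one {c m : ZMod 8} (h : c = 2 * m + 1) : c ^ 2 = 1 := by
  subst h
  revert m
  decide

theorem etaExponent_mul_T_zpow {a b c d : ℤ} (hc : Odd c) (h : a * d - b * c = 1) (n : ℤ) :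
    (24 : ℤ) ∣ etaExponent a b c d + n - etaExponent a (b + n * a) c (d + n * c) := by
  have hdet : ∀ k : ℕ, (a : ZMod k) * d - b * c = 1 := fun k ↦ by
    exact_mod_cast congrArg (Int.cast : ℤ → ZMod k) h
  apply dvd_twentyFour_of_eq_zero
  · have := hdet 3
    simp only [etaExponent]
    push_cast
    generalize (a : ZMod 3) = a, (b : ZMod 3) = b, (c : ZMod 3) = c, (d : ZMod 3) = d,
      (n : ZMod 3) = n at *
    revert a b c d n
    decide
  · have := hdet 8
    obtain ⟨m, rfl⟩ := hc
    have h2 := sq_eq_one_of_eq_two_mul_add_one (c := ((2 * m + 1 : ℤ) : ZMod 8)) (m := m)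
      (by push_cast; rfl)
    simp only [etaExponent]
    generalize 2 * m + 1 = c at *
    push_cast at *
    linear_combination (n * (a * d + b * c + n * a * c : ZMod 8) - n) * h2

/-- Multiply the determinant relation by `c * d` and use `c² = d² = 1`. -/
theorem mul_sub_mul_eq_of_det {a b c d : ZMod 8} (h : a * d - b * c = 1) (hc : c ^ 2 = 1)
    (hd : d ^ 2 = 1) : a * c - b * d = c * d := by
  linear_combination (c * d) * h + (c * d * (a * d) - (a * c - b * d) * d ^ 2) * hc -
    (a * c - b * d + c * d * (b * c)) * hd

/-- The term `12 * (n * (m + 1))` encodes the reciprocity sign, since `ζ₂₄¹² = -1`. -/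
theorem etaExponent_mul_S {a b c d m n : ℤ} (hc : c = 2 * m + 1) (hd : d = 2 * n + 1)
    (h : a * d - b * c = 1) :
    (24 : ℤ) ∣ 12 * (n * (m + 1)) + etaExponent b (-a) d (-c) - (etaExponent a b c d - 3) := by
  have hdet : ∀ k : ℕ, (a : ZMod k) * d - b * c = 1 := fun k ↦ by
    exact_mod_cast congrArg (Int.cast : ℤ → ZMod k) h
  apply dvd_twentyFour_of_eq_zero
  · have := hdet 3
    have h12 : (12 : ZMod 3) = 0 := rfl
    simp only [etaExponent]
    push_cast
    rw [h12, zero_mul]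
    clear hc hd
    generalize (a : ZMod 3) = a, (b : ZMod 3) = b, (c : ZMod 3) = c, (d : ZMod 3) = d at *
    revert a b c d
    decide
  · have h1 := hdet 8
    have hc2 := sq_eq_one_of_eq_two_mul_add_one (c := (c : ZMod 8)) (m := m)
      (by rw [hc]; push_cast; rfl)
    have hd2 := sq_eq_one_of_eq_two_mul_add_one (c := (d : ZMod 8)) (m := n)
      (by rw [hd]; push_cast; rfl)
    have h12 : ((12 * (n * (m + 1)) : ℤ) : ZMod 8) = 3 * (d - 1) * (c + 1) := by
      rw [hc, hd]; push_cast; ring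
    have key := mul_sub_mul_eq_of_det h1 hc2 hd2
    simp only [etaExponent]
    push_cast at h12 ⊢
    linear_combination h12 - key - a * c * hd2 + b * d * hc2

theorem etaExponent_mul_S_inv {a b c d m n : ℤ} (hc : c = 2 * m + 1) (hd : -d = 2 * n + 1)
    (h : a * d - b * c = 1) :
    (24 : ℤ) ∣ etaExponent (-b) a (-d) c - (12 * (m * (n + 1)) + etaExponent a b c d + 3) := by
  have hdet : ∀ k : ℕ, (a : ZMod k) * d - b * c = 1 := fun k ↦ by
    exact_mod_cast congrArg (Int.cast : ℤ → ZMod k) h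
  apply dvd_twentyFour_of_eq_zero
  · have := hdet 3
    have h12 : (12 : ZMod 3) = 0 := rfl
    simp only [etaExponent]
    push_cast
    rw [h12, zero_mul]
    clear hc hd
    generalize (a : ZMod 3) = a, (b : ZMod 3) = b, (c : ZMod 3) = c, (d : ZMod 3) = d at *
    revert a b c d
    decide
  · have h1 := hdet 8
    have hc2 := sq_eq_one_of_eq_two_mul_add_one (c := (c : ZMod 8)) (m := m)
      (by rw [hc]; push_cast; rfl)
    have hd2 := sq_eq_one_of_eq_two_mul_add_one (c := ((-d : ℤ) : ZMod 8)) (m := n)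
      (by rw [hd]; push_cast; rfl)
    push_cast at hd2
    rw [neg_sq] at hd2
    have h12 : ((12 * (m * (n + 1)) : ℤ) : ZMod 8) = 3 * (c - 1) * (-d + 1) := by
      have : (-d : ZMod 8) = 2 * n + 1 := by exact_mod_cast congrArg (Int.cast : ℤ → ZMod 8) hd
      rw [this, hc]; push_cast; ring
    have key := mul_sub_mul_eq_of_det h1 hc2 hd2
    simp only [etaExponent]
    push_cast at h12 ⊢
    linear_combination -h12 - key - a * c * hd2 + b * d * hc2

theorem neg_one_pow_eq_zeta_zpow (k : ℕ) : ((-1 : ℤ) ^ k : ℤ) = zeta 24 ^ (12 * (k : ℤ)) := by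
  rw [zpow_mul, zeta_twentyFour_zpow_twelve]
  simp

/-- The symbol of `-1` contributes `(-1)^n`, reciprocity `(-1)^(m * n)`. -/
theorem jacobiSym_neg_reciprocity {c d : ℕ} (m n : ℕ) (hc : c = 2 * m + 1) (hd : d = 2 * n + 1) :
    J(-(c : ℤ) | d) = (-1) ^ (n * (m + 1)) * J(d | c) := by
  have hc' : Odd c := ⟨m, hc⟩
  have hd' : Odd d := ⟨n, hd⟩
  rw [jacobiSym.neg _ hd', ZMod.χ₄_eq_neg_one_pow (Nat.odd_iff.mp hd'),
    jacobiSym.quadratic_reciprocity hc' hd', show c / 2 = m by omega, show d / 2 = n by omega]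
  ring

theorem etaMultiplier_mul_T_zpow {a b d : ℤ} {c : ℕ} (hc : Odd c) (h : a * d - b * c = 1)
    (n : ℤ) : etaMultiplier a b c d * zeta 24 ^ n = etaMultiplier a (b + n * a) c (d + n * c) := by
  have hJ : J(d + n * c | c) = J(d | c) := jacobiSym.mod_left' (by simp)
  rw [etaMultiplier, etaMultiplier, hJ, mul_assoc, ← zpow_add₀ (zeta_ne_zero 24)]
  congr 1
  exact zeta_zpow_congr (by norm_num) (etaExponent_mul_T_zpow (by exact_mod_cast hc) h n)

theorem etaMultiplier_mul_S {a b : ℤ} {c d : ℕ} (hc : Odd c) (hd : Odd d)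
    (h : a * d - b * c = 1) :
    zeta 24 ^ (-3 : ℤ) * etaMultiplier a b c d = etaMultiplier b (-a) d (-c) := by
  obtain ⟨m, hm⟩ := hc
  obtain ⟨n, hn⟩ := hd
  have key := zeta_zpow_congr (n := 24) (by norm_num) (etaExponent_mul_S (a := a) (b := b)
    (c := c) (d := d) (m := m) (n := n) (by exact_mod_cast hm) (by exact_mod_cast hn) h)
  have hs := neg_one_pow_eq_zeta_zpow (n * (m + 1))
  push_cast at hs
  rw [sub_eq_add_neg, zpow_add₀ (zeta_ne_zero 24), zpow_add₀ (zeta_ne_zero 24), ← hs] at key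
  rw [etaMultiplier, etaMultiplier, jacobiSym_neg_reciprocity m n hm hn]
  push_cast
  linear_combination -(J(d | c) : ℂ) * key

theorem etaMultiplier_mul_S_inv {a b : ℤ} {c d : ℕ} (hc : Odd c) (hd : Odd d)
    (h : a * -d - b * c = 1) :
    zeta 24 ^ (3 : ℤ) * etaMultiplier a b c (-d) = etaMultiplier (-b) a d c := by
  obtain ⟨m, hm⟩ := hc
  obtain ⟨n, hn⟩ := hd
  have key := zeta_zpow_congr (n := 24) (by norm_num) (etaExponent_mul_S_inv (a := a) (b := b)
    (c := c) (d := -d) (m := m) (n := n) (by exact_mod_cast hm) (by rw [neg_neg]; exact_mod_cast hn)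
    h)
  have hs := neg_one_pow_eq_zeta_zpow (m * (n + 1))
  push_cast at hs
  rw [zpow_add₀ (zeta_ne_zero 24), zpow_add₀ (zeta_ne_zero 24), ← hs, neg_neg] at key
  rw [etaMultiplier, etaMultiplier, jacobiSym_neg_reciprocity n m hn hm, key]
  push_cast
  ring

/-- A nonzero residue `r` and `r - c` have opposite parities. Choosing the odd one lets the descent
stay among odd lower-left entries. -/
theorem exists_odd_add_mul_natAbs_lt {c : ℕ} (hc : Odd c) {d : ℤ} (hcd : ¬(c : ℤ) ∣ d) :
    ∃ n e : ℤ, d = e + n * c ∧ Odd e ∧ e.natAbs < c := by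
  have hc0 : (0 : ℤ) < c := by exact_mod_cast hc.pos
  have hc' : Odd (c : ℤ) := by exact_mod_cast hc
  have hlt := Int.emod_lt_of_pos d hc0
  have hnn := Int.emod_nonneg d hc0.ne'
  have hdiv := Int.emod_add_mul_ediv d c
  rcases Int.even_or_odd (d % c) with he | ho
  · refine ⟨d / c + 1, d % c - c, by linarith, he.sub_odd hc', ?_⟩
    have : d % c ≠ 0 := fun h0 ↦ hcd (Int.dvd_of_emod_eq_zero h0)
    omega
  · exact ⟨d / c, d % c, by linarith, ho, by omega⟩

/-- The transformation formula of the Dedekind eta function for matrices with odd `c > 0`. -/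
theorem hasEtaMultiplier_of_odd {c : ℕ} (hc : Odd c) : ∀ {a b d : ℤ}, a * d - b * c = 1 →
    HasEtaMultiplier a b c d (etaMultiplier a b c d) := by
  induction c using Nat.strong_induction_on with
  | _ c ih =>
  intro a b d h
  rcases eq_or_ne c 1 with rfl | h1
  · have hb : b = a * d - 1 := by push_cast at h; linarith
    -- For `c = 1` the matrix is `T^a S T^d`.
    have := (hasEtaMultiplier_S.mul_T_zpow d).T_zpow_mul one_pos a
    convert this using 1
    · ring
    · rw [hb]; ring
    · ring
    · ring
    · rw [etaMultiplier, jacobiSym.one_right, ← zpow_add₀ (zeta_ne_zero 24),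
        ← zpow_add₀ (zeta_ne_zero 24), etaExponent, Int.cast_one, one_mul]
      congr 1
      push_cast
      ring
  · have hcd : ¬(c : ℤ) ∣ d := fun hcd ↦ h1 <| by
      have : (c : ℤ) ∣ 1 := h ▸ dvd_sub (hcd.mul_left a) (dvd_mul_left _ b)
      exact Nat.dvd_one.mp (by exact_mod_cast this)
    obtain ⟨n, e, rfl, he, hlt⟩ := exists_odd_add_mul_natAbs_lt hc hcd
    obtain ⟨b, rfl⟩ : ∃ b', b = b' + n * a := ⟨b - n * a, by ring⟩
    have hdet : a * e - b * c = 1 := by linarith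
    rw [← etaMultiplier_mul_T_zpow hc hdet]
    apply HasEtaMultiplier.mul_T_zpow
    have ho : Odd e.natAbs := Int.natAbs_odd.mpr he
    have hpos : (0 : ℤ) < e.natAbs := by exact_mod_cast ho.pos
    have hc0 : (0 : ℤ) < c := by exact_mod_cast hc.pos
    -- The matrix `(a b; c e)` comes from one with lower-left entry `|e| < c` by `S⁻¹` or `S`, up to
    -- sign, according to the sign of `e`.
    rcases lt_or_ge 0 e with hp | hn
    · have hE : (e.natAbs : ℤ) = e := Int.natAbs_of_nonneg hp.le
      have hdet' : b * -(c : ℤ) - -a * e.natAbs = 1 := by rw [hE]; linarith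
      have := (ih _ hlt ho hdet').mul_S_inv hpos (by omega)
      rwa [etaMultiplier_mul_S_inv ho hc hdet', neg_neg, neg_neg, hE] at this
    · have hE : (e.natAbs : ℤ) = -e := Int.ofNat_natAbs_of_nonpos hn
      have hdet' : -b * c - a * e.natAbs = 1 := by rw [hE]; linarith
      have := (ih _ hlt ho hdet').mul_S hpos hc0
      rwa [etaMultiplier_mul_S ho hc hdet', neg_neg, hE, neg_neg] at this

/-- The multiplier of `η` for `(1 -1; 2 -1)`. -/
theorem hasEtaMultiplier_two : HasEtaMultiplier 1 (-1) 2 (-1) (zeta 24 ^ (-3 : ℤ)) := by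
  -- The matrix factors as `T S T² S`.
  have h := ((hasEtaMultiplier_S.mul_T_zpow 2).T_zpow_mul one_pos 1).mul_S one_pos two_pos
  convert h using 1
  · norm_num
  · norm_num
  · norm_num
  rw [← zpow_add₀ (zeta_ne_zero 24), ← zpow_add₀ (zeta_ne_zero 24),
    ← zpow_add₀ (zeta_ne_zero 24)]
  norm_num

/-! ### The matrix `(ρ -w; p -ϖ)` and the two identities -/

theorem negInv_eq {p ρ ϖ : ℕ} {w : ℤ} (hρp : ρ < p) (h : (1 : ℤ) = -(ϖ : ℤ) * ρ + w * p)
    [Fact p.Prime] : negInv p ϖ = ρ := by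
  have h1 : (1 : ZMod p) = -(ϖ : ZMod p) * ρ := by
    simpa using congrArg (Int.cast : ℤ → ZMod p) h
  have h2 : -(ϖ : ZMod p)⁻¹ = ρ := by
    have : (ϖ : ZMod p) ≠ 0 := by
      rintro h0
      simp [h0] at h1
    field_simp
    linear_combination -h1
  rw [negInv, h2, ZMod.val_natCast_of_lt hρp]

theorem cofactor_eq {p ρ ϖ : ℕ} {w : ℤ} (hρp : ρ < p) (h : (1 : ℤ) = -(ϖ : ℤ) * ρ + w * p)
    [hp : Fact p.Prime] : cofactor p ϖ = w := by
  rw [cofactor, negInv_eq hρp h]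
  exact Int.ediv_eq_of_eq_mul_left (by exact_mod_cast hp.out.ne_zero) (by linarith)

/-- The target exponent is `2(ρ - 3) - (ρp - 3)`: the squared numerator of `A_{ρp}` at `-1/z`
against the factor `η(-1/z + ρp)`. -/
theorem dvd_theta_add_etaExponent_sub {p ρ ϖ w : ℤ} {m : ℤ} (hp : p = 2 * m + 1)
    (h : 1 = -ϖ * ρ + w * p) :
    (24 : ℤ) ∣ p * ϖ * (1 - ρ ^ 2) + (-3 * p + 2 + w) * ρ - 3 + 3 * p +
      etaExponent ρ (-w) p (-ϖ) - (2 * ρ - ρ * p - 3) := by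
  have hmod : ∀ k : ℕ, (1 : ZMod k) = -ϖ * ρ + w * p := fun k ↦ by
    exact_mod_cast congrArg (Int.cast : ℤ → ZMod k) h
  apply dvd_twentyFour_of_eq_zero
  · have := hmod 3
    simp only [etaExponent]
    push_cast
    clear hp h
    generalize (p : ZMod 3) = p, (ρ : ZMod 3) = ρ, (ϖ : ZMod 3) = ϖ, (w : ZMod 3) = w at *
    revert p ρ ϖ w
    decide
  · have h1 := hmod 8
    have h2 := sq_eq_one_of_eq_two_mul_add_one (c := (p : ZMod 8)) (m := m)
      (by rw [hp]; push_cast; rfl)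
    simp only [etaExponent]
    push_cast
    linear_combination -(p * ρ) * h1 - (w * (ϖ + ρ)) * h2

theorem hasEtaMultiplier_sign_theta {p ρ ϖ : ℕ} {w : ℤ} [hp : Fact p.Prime] (hρ : 1 ≤ ρ)
    (hρp : ρ < p) (hϖ : 1 ≤ ϖ) (hϖp : ϖ < p) (h : (1 : ℤ) = -(ϖ : ℤ) * ρ + w * p) :
    ∃ u : ℂ, HasEtaMultiplier ρ (-w) p (-ϖ) u ∧
      (sign p ϖ : ℂ) * zeta 24 ^ theta p ϖ * u = zeta 24 ^ (2 * ρ - ρ * p - 3 : ℤ) := by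
  rcases eq_or_ne p 2 with rfl | hp2
  · obtain rfl : ρ = 1 := by omega
    obtain rfl : ϖ = 1 := by omega
    obtain rfl : w = 1 := by push_cast at h; omega
    refine ⟨_, hasEtaMultiplier_two, ?_⟩
    simp [sign, theta]
  · have hodd := hp.out.odd_of_ne_two hp2
    obtain ⟨m, hm⟩ := id hodd
    refine ⟨_, hasEtaMultiplier_of_odd hodd (by linarith), ?_⟩
    -- The same Legendre symbol occurs in `ε(ϖ)` and in the multiplier, so the two cancel.
    have hsq : (legendreSym p (-ϖ) : ℂ) * legendreSym p (-ϖ) = 1 := by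
      have h0 : ((-ϖ : ℤ) : ZMod p) ≠ 0 := by
        push_cast
        rw [neg_ne_zero, Ne, ZMod.natCast_eq_zero_iff]
        exact Nat.not_dvd_of_pos_of_lt hϖ hϖp
      have := legendreSym.sq_one p h0
      rw [← sq]
      exact_mod_cast this
    rw [etaMultiplier, ← jacobiSym.legendreSym.to_jacobiSym, sign, theta, if_neg hp2, if_neg hp2,
      negInv_eq hρp h, cofactor_eq hρp h]
    have key := zeta_zpow_congr (n := 24) (by norm_num)
      (dvd_theta_add_etaExponent_sub (p := p) (m := m) (by exact_mod_cast hm) h)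
    rw [zpow_add₀ (zeta_ne_zero 24) _ (etaExponent _ _ _ _)] at key
    rw [← key, mul_mul_mul_comm, hsq, one_mul]

theorem coe_S_smul (z : UpperHalfPlane) :
    ((ModularGroup.S • z : UpperHalfPlane) : ℂ) = -1 / z := by
  rw [UpperHalfPlane.modular_S_smul]
  simp [neg_div, inv_neg]

theorem conjA_S_smul {p ρ ϖ : ℕ} {w : ℤ} [hp : Fact p.Prime] (hρ : 1 ≤ ρ)
    (hρp : ρ < p) (hϖ : 1 ≤ ϖ) (hϖp : ϖ < p) (h : (1 : ℤ) = -(ϖ : ℤ) * ρ + w * p)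
    (z : UpperHalfPlane) :
    conjA p p (ρ * p) (ModularGroup.S • z) = conjC p ϖ z := by
  obtain ⟨u, hu, hε⟩ := hasEtaMultiplier_sign_theta hρ hρp hϖ hϖp h
  have hp0 : (p : ℂ) ≠ 0 := by exact_mod_cast hp.out.ne_zero
  have hz : 0 < (z : ℂ).im := z.im_pos
  have hz0 := ne_zero_of_im_pos hz
  have hpz : 0 < ((p : ℂ) * z).im := by
    have := hp.out.pos
    simp only [mul_im, natCast_re, natCast_im, zero_mul, add_zero]
    positivity
  have hz' : 0 < ((z : ℂ) + ϖ / p).im := by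
    have : ((ϖ : ℂ) / p).im = 0 := by
      rw [← ofReal_natCast, ← ofReal_natCast, ← ofReal_div, ofReal_im]
    rw [add_im, this, add_zero]
    exact hz
  have h1 : ModularForm.eta ((-1 / z + (ρ * p : ℕ)) / p) =
      zeta 24 ^ (ρ : ℤ) * (zeta 24 ^ (-3 : ℤ) * sqrt (p * z) * ModularForm.eta (p * z)) := by
    rw [← eta_neg_one_div hpz, ← eta_add_int]
    congr 1
    push_cast
    field_simp
  have h2 : ModularForm.eta (-1 / z + (ρ * p : ℕ)) =
      zeta 24 ^ (ρ * p : ℤ) * (zeta 24 ^ (-3 : ℤ) * sqrt z * ModularForm.eta z) := by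
    rw [← eta_neg_one_div hz, ← eta_add_int]
    push_cast
    rfl
  have h3 : ModularForm.eta ((-1 / z + (ρ * p : ℕ)) / (p * p)) =
      u * sqrt (p * z) * ModularForm.eta (z + ϖ / p) := by
    have hw : (w : ℂ) * p = 1 + ϖ * ρ := by
      have := congrArg (Int.cast : ℤ → ℂ) h
      push_cast at this
      linear_combination -this
    have hden : ((p : ℤ) : ℂ) * (z + ϖ / p) + (-ϖ : ℤ) = p * z := by
      push_cast
      field_simp
      ring
    have := hu _ hz'
    rw [hden] at this
    rw [← this]
    congr 1
    push_cast
    field_simp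
    linear_combination hw
  have hu0 : u ≠ 0 := by
    rintro rfl
    rw [mul_zero] at hε
    exact zpow_ne_zero _ (zeta_ne_zero 24) hε.symm
  have hη1 := ModularForm.eta_ne_zero hz
  have hη2 := ModularForm.eta_ne_zero hz'
  have hζ := zeta_ne_zero 24
  have hsz : sqrt (z : ℂ) ≠ 0 := by
    intro h0
    have := sqrt_sq (z : ℂ)
    rw [h0] at this
    exact hz0 (by simpa using this.symm)
  have hsp : (Real.sqrt p : ℂ) ≠ 0 := by
    exact_mod_cast (Real.sqrt_pos.mpr (by exact_mod_cast hp.out.pos)).ne'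
  rw [conjA, doubleEta, coe_S_smul, h1, h2, h3, conjC, sqrt_natCast_mul hz0 hp.out.pos]
  have hε' : (sign p ϖ : ℂ) * zeta 24 ^ theta p ϖ =
      zeta 24 ^ (2 * ρ - ρ * p - 3 : ℤ) / u := eq_div_of_mul_eq hu0 hε
  rw [mul_assoc (Real.sqrt p : ℂ), hε', show (2 * ρ - ρ * p - 3 : ℤ) =
    ρ + ρ + (-3) + -(ρ * p) by ring, zpow_add₀ hζ, zpow_add₀ hζ, zpow_add₀ hζ,
    zpow_neg _ (ρ * p : ℤ)]
  field_simp

end DoubleEta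

theorem mainTheorem6 (p : ℕ) [Fact p.Prime] :
    (∀ ρ : ℕ, 1 ≤ ρ → ρ < p →
      ∀ (ϖ : ℕ) (w : ℤ), 1 ≤ ϖ → ϖ < p → (1 : ℤ) = -(ϖ : ℤ) * ρ + w * p →
        ∀ z : UpperHalfPlane,
          DoubleEta.conjA p p (ρ * p) (ModularGroup.S • z) = DoubleEta.conjC p ϖ z) ∧
    (∀ ν : ℕ, 1 ≤ ν → ν < p →
      ∀ μ : ℕ, 1 ≤ μ → μ < p → (μ : ZMod p) = -1 / (ν : ZMod p) →
        ∀ z : UpperHalfPlane,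
          DoubleEta.conjC p ν (ModularGroup.S • z) = DoubleEta.conjA p p (μ * p) z) := by
  refine ⟨fun ρ h1 h2 ϖ w h3 h4 h z ↦ DoubleEta.conjA_S_smul h1 h2 h3 h4 h z,
    fun ν h1 h2 μ h3 h4 h z ↦ ?_⟩
  have hμ : μ = DoubleEta.negInv p ν := by
    rw [DoubleEta.negInv, ← ZMod.val_natCast_of_lt h4, h, neg_div, one_div]
  have hspec := (DoubleEta.negInv_spec p ν h1 h2).2.2
  rw [← hμ] at hspec
  -- The relation `1 = -μν + vp` is symmetric in `μ` and `ν`, so (i) applies with `ρ = μ`, `ϖ = ν`;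
  -- what remains is `S • S • z = z`.
  rw [← DoubleEta.conjA_S_smul (w := DoubleEta.cofactor p ν) h3 h4 h1 h2 (by linarith)]
  congr 1
  ext1
  rw [DoubleEta.coe_S_smul, DoubleEta.coe_S_smul]
  have := z.ne_zero
  field_simp
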